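/- For $m<\omega$ let $H_m$ be the set of injections from $m=\{0,\dots,m-1\}$ into $\omega$, let $[\omega]^m$ be the set of $m$-element subsets of $\omega$, and let $\phi\colon H_m\to[\omega]^m$ send an injection to its range. Let $S(S_\infty)=\varprojlim_m \beta H_m$ be the Samuel compactification of $S_\infty$ (the inverse limit is along the restriction maps), and let $\alpha(m)\in\beta H_m$ be the $m$-th coordinate of $\alpha\in S(S_\infty)$. For $f\in H_m$ let $\alpha\cdot f\in\beta H_m$ be the ultrafilter with $T\in\alpha\cdot f\Leftrightarrow\{x\in H_n: x\circ f\in T\}\in\alpha(n)$, for any $n$ such that $f$ takes values in $n$. The semigroup product on $S(S_\infty)$ is given by $T\in(\alpha\gamma)(m)\Leftrightarrow\{f\in H_m:T\in\alpha\cdot f\}\in\gamma(m)$, and the right action of $g\in S_\infty$ by $(\alpha g)(m)=\alpha\cdot (g|_m)$. A subflow is a nonempty closed set invariant under this action. For $M\subseteq S(S_\infty)$ let $\mathcal F_m^M=\{A\subseteq H_m: A\in\alpha(m)\text{ for all }\alpha\in M\}$, and let $\phi(\mathcal F_m^M)$ be its push-forward to $[\omega]^m$. A set $T\subseteq H_m$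 is thick if for every $n\ge m$ there is $s\in H_n$ with $s\circ f\in T$ for every injection $f\colon m\to n$; a set $T\subseteq[\omega]^m$ is thick if for every $n\ge m$ there is $s\in[\omega]^n$ with $[s]^m\subseteq T$. A filter or ultrafilter is thick if all its members are thick. Theorem. Let $M\subseteq S(S_\infty)$ be a minimal right ideal. Then for every $m<\omega$, $\phi(\mathcal F_m^M)$ is a thick ultrafilter on $[\omega]^m$. Conversely, if $m<\omega$ and $p\in\beta[\omega]^m$ is a thick ultrafilter, then $\{\phi^{-1}(T):T\in p\}$ generates a maximal thick filter on $H_m$ (maximal under inclusion among thick filters on $H_m$), and there is $M\subseteq S(S_\infty)$, which is both a minimal right ideal and a minimal subflow, with $p=\phi(\mathcal F_m^M)$. -/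

import Mathlib

/-- `H m` is the set of injections from `m = {0, ..., m-1}` into `ω`. -/
abbrev H (m : ℕ) : Type := Fin m ↪ ℕ

/-- The dual map `H n → H m`, `x ↦ x ∘ f`, of an injection `f : m → n`. -/
def dual {m n : ℕ} (f : Fin m ↪ Fin n) : H n → H m := fun x => f.trans x

/-- The Samuel compactification `S(S_∞)`, as the inverse limit of the spaces `β H_n` of
ultrafilters along the restriction maps `β H_n → β H_m` for `m ≤ n`. -/
def SamuelSInf : Type :=
  {α : (n : ℕ) → Ultrafilter (H n) //
    ∀ (m n : ℕ) (h : m ≤ n), (α n).map (dual (Fin.castLEEmb h)) = α m}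

namespace SamuelSInf

/-- The topology of the inverse limit: the subspace topology of the product of the `β H_n`. -/
instance : TopologicalSpace SamuelSInf := instTopologicalSpaceSubtype

/-- The projection `π_m : S(S_∞) → β H_m`. -/
def proj (m : ℕ) (α : SamuelSInf) : Ultrafilter (H m) := α.1 m

/-- An injection `f : m → ω` with range contained in `n`, seen as an injection `m → n`. -/
def corestrict {m : ℕ} (f : H m) (n : ℕ) (h : ∀ i, f i < n) : Fin m ↪ Fin n :=
  ⟨fun i => ⟨f i, h i⟩, fun _ _ hij => f.injective (congrArg Fin.val hij)⟩

/-- The least `n` such that the range of `f` is contained in `n`. -/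
def bound {m : ℕ} (f : H m) : ℕ := Finset.univ.sup fun i => f i + 1

theorem lt_bound {m : ℕ} (f : H m) (i : Fin m) : f i < bound f :=
  Finset.le_sup (f := fun i => f i + 1) (Finset.mem_univ i)

/-- `α · f ∈ β H_m` for `α ∈ S(S_∞)` and `f ∈ H m`: a set `T ⊆ H m` belongs to `α · f` iff
`{x ∈ H n : x ∘ f ∈ T} ∈ α(n)`, where `n` is such that the range of `f` is contained in `n`. The
least such `n` is used; by `app_eq` every other one gives the same ultrafilter. -/
def app {m : ℕ} (α : SamuelSInf) (f : H m) : Ultrafilter (H m) :=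
  (α.proj (bound f)).map (dual (corestrict f (bound f) (lt_bound f)))

theorem app_eq {m : ℕ} (α : SamuelSInf) (f : H m) (n : ℕ) (h : ∀ i, f i < n) :
    α.app f = (α.proj n).map (dual (corestrict f n h)) := by
  have hb : bound f ≤ n := Finset.sup_le fun i _ => h i
  have := α.2 _ _ hb
  unfold app proj
  rw [← this, Ultrafilter.map_map]
  rfl

theorem map_app {m n : ℕ} (α : SamuelSInf) (e : Fin m ↪ Fin n) (f : H n) :
    (α.app f).map (dual e) = α.app (dual e f) := by
  rw [app_eq α (dual e f) (bound f) (fun i => lt_bound f (e i)), app, Ultrafilter.map_map]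
  rfl

/-- The restriction `g|_m` of `H m` given by a permutation `g` of `ω`. -/
def restrict (g : Equiv.Perm ℕ) (m : ℕ) : H m := Fin.valEmbedding.trans g.toEmbedding

/-- The right action of `S_∞` on `S(S_∞)`: `(α g)(m) = α · g|_m`. -/
def act (α : SamuelSInf) (g : Equiv.Perm ℕ) : SamuelSInf :=
  ⟨fun m => α.app (restrict g m), fun _ _ _ => map_app _ _ _⟩

/-- The product of `S(S_∞)`: a set `T ⊆ H m` belongs to `(α γ)(m)` iff
`{f ∈ H m : T ∈ α · f} ∈ γ(m)`. -/
instance : Mul SamuelSInf where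
  mul α γ := ⟨fun m => (γ.proj m).bind fun f => α.app f, by
    intro m n h
    change ((γ.proj n).bind fun f => α.app f).map _ = (γ.proj m).bind fun f => α.app f
    rw [← (show _ = γ.proj m from γ.2 m n h)]
    ext T
    change {f | (dual (Fin.castLEEmb h)) ⁻¹' T ∈ α.app f} ∈ γ.proj n ↔
      {f | T ∈ α.app (dual (Fin.castLEEmb h) f)} ∈ γ.proj n
    simp only [← map_app, Ultrafilter.mem_map]⟩

theorem mem_proj_mul {m : ℕ} (α γ : SamuelSInf) (T : Set (H m)) :
    T ∈ (α * γ).proj m ↔ {f | T ∈ α.app f} ∈ γ.proj m := Iff.rfl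

theorem mem_proj_act {m : ℕ} (α : SamuelSInf) (g : Equiv.Perm ℕ) (T : Set (H m)) (n : ℕ)
    (h : ∀ i, restrict g m i < n) :
    T ∈ (α.act g).proj m ↔
      {x : H n | (corestrict (restrict g m) n h).trans x ∈ T} ∈ α.proj n := by
  change T ∈ α.app (restrict g m) ↔ _
  rw [app_eq α _ n h]
  rfl

theorem mul_app {m : ℕ} (α γ : SamuelSInf) (f : H m) (T : Set (H m)) :
    T ∈ (α * γ).app f ↔ {x | T ∈ α.app x} ∈ γ.app f := by
  change {x | _ ∈ α.app x} ∈ γ.proj (bound f) ↔ {y | T ∈ α.app (dual _ y)} ∈ γ.proj (bound f)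
  simp only [← map_app, Ultrafilter.mem_map]

instance : Semigroup SamuelSInf where
  mul_assoc α γ δ := by
    refine Subtype.ext (funext fun m => Ultrafilter.ext fun T => ?_)
    change {f | T ∈ (α * γ).app f} ∈ δ.proj m ↔ {f | {x | T ∈ α.app x} ∈ γ.app f} ∈ δ.proj m
    simp only [mul_app]

/-- A right ideal: a nonempty set `I` with `I · S(S_∞) ⊆ I`. -/
def IsRightIdeal (I : Set SamuelSInf) : Prop :=
  I.Nonempty ∧ ∀ α ∈ I, ∀ γ : SamuelSInf, α * γ ∈ I

/-- A minimal right ideal. -/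
def IsMinimalRightIdeal (M : Set SamuelSInf) : Prop :=
  IsRightIdeal M ∧ ∀ I : Set SamuelSInf, IsRightIdeal I → I ⊆ M → I = M

/-- A subflow: a nonempty closed set that is invariant under the right action of `S_∞`. -/
def IsSubflow (Y : Set SamuelSInf) : Prop :=
  Y.Nonempty ∧ IsClosed Y ∧ ∀ α ∈ Y, ∀ g : Equiv.Perm ℕ, α.act g ∈ Y

/-- A minimal subflow: a subflow without proper subflows. -/
def IsMinimalSubflow (M : Set SamuelSInf) : Prop :=
  IsSubflow M ∧ ∀ Y : Set SamuelSInf, IsSubflow Y → Y ⊆ M → Y = M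

/-- The level-`m` filter `{A ⊆ H m : π_m(Y) ⊆ closure of A in β H_m}` of `Y ⊆ S(S_∞)`; an
ultrafilter lies in the closure of `A` iff it contains `A`. -/
def levelFilter (Y : Set SamuelSInf) (m : ℕ) : Filter (H m) where
  sets := {A | proj m '' Y ⊆ {q | A ∈ q}}
  univ_sets := fun _ _ => Filter.univ_mem
  sets_of_superset := fun hA hAB _ hq => Filter.mem_of_superset (hA hq) hAB
  inter_sets := fun hA hB _ hq => Filter.inter_mem (hA hq) (hB hq)

end SamuelSInf

/-- `[ω]^m`, the set of subsets of `ω` with exactly `m` elements. -/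
abbrev FinSubsets (m : ℕ) : Type := Set.powersetCard ℕ m

/-- The order forgetful map `H m → [ω]^m`, sending an injection to its range. -/
def forget (m : ℕ) (x : H m) : FinSubsets m :=
  ⟨Finset.univ.map x, by simp⟩

/-- `T ⊆ H m` is thick: for every `n ≥ m` there is `s ∈ H n` with `s ∘ f ∈ T` for every
injection `f : m → n`. -/
def IsThickH {m : ℕ} (T : Set (H m)) : Prop :=
  ∀ n, m ≤ n → ∃ s : H n, ∀ f : Fin m ↪ Fin n, f.trans s ∈ T

/-- `T ⊆ [ω]^m` is thick: for every `n ≥ m` there is `s ∈ [ω]^n` with `[s]^m ⊆ T`. -/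
def IsThickSub {m : ℕ} (T : Set (FinSubsets m)) : Prop :=
  ∀ n, m ≤ n → ∃ s : FinSubsets n, ∀ t : FinSubsets m, (t : Finset ℕ) ⊆ (s : Finset ℕ) → t ∈ T

/-- A thick filter on `H m`: a filter all of whose members are thick. It is automatically
proper, as `∅` is not thick. -/
def IsThickFilterH {m : ℕ} (F : Filter (H m)) : Prop := ∀ T ∈ F, IsThickH T

/-- A maximal thick filter on `H m`, with respect to inclusion of filters as families of sets. -/
def IsMaximalThickFilterH {m : ℕ} (F : Filter (H m)) : Prop :=
  IsThickFilterH F ∧ ∀ F' : Filter (H m), IsThickFilterH F' → F.sets ⊆ F'.sets → F' = F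

/-- A thick ultrafilter on `[ω]^m`: an ultrafilter all of whose members are thick. -/
def IsThickUltrafilter {m : ℕ} (p : Ultrafilter (FinSubsets m)) : Prop :=
  ∀ T ∈ p, IsThickSub T

/-!
For an injection `h : ω → ω` the principal ultrafilters at the restrictions `h|_m` form a point
`ofEmb h` of `S(S_∞)`, and `(α * ofEmb h) · f = α · (h ∘ f)`. Hence, for a right ideal `M`, a set
lies in `levelFilter M m` iff it lies in `α · f` for all `α ∈ M` and `f ∈ H m`
(`mem_levelFilter_iff_app`). As `α(n)` is a proper filter and there are only finitely many
injections `m → n`, such a set is thick (`isThickH_of_forall_mem_app`).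

Let `M` be a minimal right ideal, `α ∈ M` and `T ⊆ [ω]^m`. Whether `φ⁻¹(T) ∈ α · f` depends only on
the range of `f`, so this is a 2-colouring of `[ω]^m`. Ramsey's theorem
(`exists_embedding_homogeneous`) gives an injection `h` with homogeneous range, and then
`β = α * ofEmb h` satisfies `φ⁻¹(T) ∈ β · f` for all `f`, or `φ⁻¹(Tᶜ) ∈ β · f` for all `f`. Since
`M = β S(S_∞)` by minimality, `T` or `Tᶜ` lies in the push-forward of `levelFilter M m`, which is
therefore an ultrafilter.

Conversely, let `p` be a thick ultrafilter. If a thick filter `F'` contains all `φ⁻¹(T)`, `T ∈ p`,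
and `A ∈ F'`, then the set of those `t` all of whose enumerations lie in `A` must belong to `p`:
otherwise the set of `x ∈ A` with some re-enumeration outside `A` would be in `F'`, and thickness
at `n = m` forbids this. So the filter generated by the `φ⁻¹(T)` is maximal thick. The set of all
`α` with `φ⁻¹(T) ∈ α · f` for all `T ∈ p` and all `f` is a subflow, nonempty by compactness of
`S(S_∞)` and thickness of `p`. By Zorn's lemma it contains a minimal subflow `M`, which is a minimal
right ideal because `S_∞` is dense in `S(S_∞)` and left multiplications are continuous. The
push-forward of `levelFilter M m` is a proper filter containing the ultrafilter `p`, so it is `p`.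
-/

/-! ### Ramsey's theorem -/

/-- `C` holds for `s` enlarged by `k` further elements, where each of these ranges over most natural
numbers in the sense of a fixed nonprincipal ultrafilter. -/
def EventuallyExtends (C : Finset ℕ → Prop) : ℕ → Finset ℕ → Prop
  | 0, s => C s
  | k + 1, s => ∀ᶠ a in (Filter.hyperfilter ℕ : Filter ℕ), EventuallyExtends C k (insert a s)

theorem eventuallyExtends_not (C : Finset ℕ → Prop) (k : ℕ) (s : Finset ℕ) :
    EventuallyExtends (fun t => ¬ C t) k s ↔ ¬ EventuallyExtends C k s := by
  induction k generalizing s with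
  | zero => exact Iff.rfl
  | succ k ih =>
    simp only [EventuallyExtends, ih]
    exact Ultrafilter.eventually_not

theorem exists_embedding_of_eventuallyExtends (C : Finset ℕ → Prop) (m : ℕ)
    (h0 : EventuallyExtends C m ∅) :
    ∃ h : ℕ ↪ ℕ, ∀ t : Finset ℕ, t.card = m → C (t.map h) := by
  let good : Finset ℕ → Prop := fun F =>
    ∀ s ⊆ F, s.card ≤ m → EventuallyExtends C (m - s.card) s
  have good_empty : good ∅ := by
    intro s hs _
    rw [Finset.subset_empty.1 hs]
    exact h0
  -- A good set can be enlarged by most numbers, as only finitely many conditions are imposed.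
  have step : ∀ F : {F // good F}, ∃ a : ℕ, (∀ b ∈ F.1, b < a) ∧ good (insert a F.1) := by
    rintro ⟨F, hF⟩
    have h1 : ∀ᶠ a in (Filter.hyperfilter ℕ : Filter ℕ), ∀ b ∈ F, b < a := by
      rw [Filter.eventually_all_finset]
      intro b _
      have : ∀ᶠ a in (Filter.cofinite : Filter ℕ), b < a := by
        rw [Nat.cofinite_eq_atTop]
        exact Filter.eventually_gt_atTop b
      exact Filter.hyperfilter_le_cofinite this
    have h2 : ∀ᶠ a in (Filter.hyperfilter ℕ : Filter ℕ), ∀ s ∈ F.powerset,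
        s.card + 1 ≤ m → EventuallyExtends C (m - (s.card + 1)) (insert a s) := by
      rw [Filter.eventually_all_finset]
      intro s hs
      by_cases hm : s.card + 1 ≤ m
      · have := hF s (Finset.mem_powerset.1 hs) (by omega)
        rw [show m - s.card = m - (s.card + 1) + 1 by omega] at this
        exact Filter.Eventually.mono this fun a ha _ => ha
      · exact Filter.Eventually.of_forall fun a ha => absurd ha hm
    obtain ⟨a, ha1, ha2⟩ := (h1.and h2).exists
    refine ⟨a, ha1, fun s hs hcard => ?_⟩
    by_cases has : a ∈ s
    · have hsub : s.erase a ⊆ F := by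
        rw [← Finset.subset_insert_iff]; exact hs
      have hc : (s.erase a).card + 1 = s.card := Finset.card_erase_add_one has
      have := ha2 _ (Finset.mem_powerset.2 hsub) (by omega)
      rwa [Finset.insert_erase has, hc] at this
    · exact hF s ((Finset.subset_insert_iff_of_notMem has).1 hs) hcard
  choose next hlt hgood using step
  let F : ℕ → {F // good F} := fun n =>
    Nat.rec ⟨∅, good_empty⟩ (fun _ G => ⟨insert (next G) G.1, hgood G⟩) n
  have hF : ∀ n, (F (n + 1)).1 = insert (next (F n)) (F n).1 := fun _ => rfl
  have hmem : ∀ n k, k < n → next (F k) ∈ (F n).1 := by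
    intro n
    induction n with
    | zero => intro k hk; omega
    | succ n ih =>
      intro k hk
      rw [hF]
      rcases Nat.lt_succ_iff_lt_or_eq.1 hk with h | rfl
      · exact Finset.mem_insert_of_mem (ih k h)
      · exact Finset.mem_insert_self _ _
  have hmono : StrictMono fun n => next (F n) := fun k n hkn => hlt (F n) _ (hmem n k hkn)
  refine ⟨⟨fun n => next (F n), hmono.injective⟩, fun t ht => ?_⟩
  have hsub : t.map ⟨fun n => next (F n), hmono.injective⟩ ⊆ (F (t.sup id + 1)).1 := by
    intro a ha
    obtain ⟨k, hk, rfl⟩ := Finset.mem_map.1 ha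
    exact hmem _ k (Nat.lt_succ_of_le (Finset.le_sup (f := id) hk))
  have := (F (t.sup id + 1)).2 _ hsub (by rw [Finset.card_map, ht])
  rwa [Finset.card_map, ht, Nat.sub_self] at this

/-- The infinite Ramsey theorem for 2-colourings of the `m`-element subsets of `ℕ`. -/
theorem exists_embedding_homogeneous (C : Finset ℕ → Prop) (m : ℕ) :
    ∃ h : ℕ ↪ ℕ, (∀ t : Finset ℕ, t.card = m → C (t.map h)) ∨
      (∀ t : Finset ℕ, t.card = m → ¬ C (t.map h)) := by
  by_cases h0 : EventuallyExtends C m ∅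
  · obtain ⟨h, hh⟩ := exists_embedding_of_eventuallyExtends C m h0
    exact ⟨h, Or.inl hh⟩
  · obtain ⟨h, hh⟩ := exists_embedding_of_eventuallyExtends (fun t => ¬ C t) m
      ((eventuallyExtends_not C m ∅).2 h0)
    exact ⟨h, Or.inr hh⟩

/-! ### Injections and their ranges -/

/-- Every injection `n → ω` is the restriction of a permutation of `ω`. -/
theorem exists_perm_restrict_eq {n : ℕ} (f : H n) :
    ∃ g : Equiv.Perm ℕ, SamuelSInf.restrict g n = f := by
  have := Equiv.Perm.isMultiplyPretransitive ℕ n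
  obtain ⟨g, hg⟩ := MulAction.exists_smul_eq (Equiv.Perm ℕ) (Fin.valEmbedding : Fin n ↪ ℕ) f
  exact ⟨g, by rw [← hg]; rfl⟩

theorem forget_eq_iff {m : ℕ} (x y : H m) : forget m x = forget m y ↔ Set.range x = Set.range y := by
  rw [Subtype.ext_iff, ← Finset.coe_inj]
  simp [forget]

theorem forget_orderEmbOfFin {m : ℕ} (t : FinSubsets m) (ht : (t : Finset ℕ).card = m) :
    forget m ((t : Finset ℕ).orderEmbOfFin ht).toEmbedding = t := by
  apply Subtype.ext
  rw [← Finset.coe_inj, ← Finset.range_orderEmbOfFin (t : Finset ℕ) ht]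
  ext a
  simp [forget]

/-- A member of `[ω]^m` contained in the range of `s ∈ H n` is the range of `s ∘ f` for some
`f : m → n`. -/
theorem exists_forget_trans_eq {m n : ℕ} (s : H n) (t : FinSubsets m)
    (h : (t : Finset ℕ) ⊆ (forget n s : Finset ℕ)) :
    ∃ f : Fin m ↪ Fin n, forget m (f.trans s) = t := by
  have ht : (t : Finset ℕ).card = m := t.2
  have hmem : ∀ i : Fin m, ∃ j : Fin n, s j = (t : Finset ℕ).orderEmbOfFin ht i := by
    intro i
    have := h (Finset.orderEmbOfFin_mem (t : Finset ℕ) ht i)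
    simpa [forget] using this
  choose f hf using hmem
  have hinj : Function.Injective f := fun i j hij =>
    ((t : Finset ℕ).orderEmbOfFin ht).injective (by rw [← hf, ← hf, hij])
  have hfun : (⟨f, hinj⟩ : Fin m ↪ Fin n).trans s =
      ((t : Finset ℕ).orderEmbOfFin ht).toEmbedding := DFunLike.ext _ _ hf
  exact ⟨⟨f, hinj⟩, hfun ▸ forget_orderEmbOfFin t ht⟩

theorem forget_surjective (n : ℕ) : Function.Surjective (forget n) :=
  fun t => ⟨_, forget_orderEmbOfFin t t.2⟩

theorem isThickH_preimage_forget_iff {m : ℕ} {T : Set (FinSubsets m)} :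
    IsThickH (forget m ⁻¹' T) ↔ IsThickSub T := by
  refine forall₂_congr fun n _ => ⟨?_, ?_⟩
  · rintro ⟨s, hs⟩
    refine ⟨forget n s, fun t ht => ?_⟩
    obtain ⟨f, rfl⟩ := exists_forget_trans_eq s t ht
    exact hs f
  · rintro ⟨s, hs⟩
    obtain ⟨s, rfl⟩ := forget_surjective n s
    refine ⟨s, fun f => hs _ fun a ha => ?_⟩
    simp only [forget, Finset.mem_map, Finset.mem_univ, true_and] at ha ⊢
    obtain ⟨i, rfl⟩ := ha
    exact ⟨f i, rfl⟩

theorem IsThickH.mono {m : ℕ} {S T : Set (H m)} (hS : IsThickH S) (h : S ⊆ T) : IsThickH T :=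
  fun n hn => (hS n hn).imp fun _ hs f => h (hs f)

/-! ### The filter on `H m` induced by a thick ultrafilter -/

theorem generate_preimage_eq_comap {α β : Type*} (φ : α → β) (p : Filter β) :
    Filter.generate {S : Set α | ∃ T ∈ p, S = φ ⁻¹' T} = Filter.comap φ p := by
  apply le_antisymm
  · rintro S ⟨T, hT, hTS⟩
    exact Filter.mem_of_superset (Filter.GenerateSets.basic ⟨T, hT, rfl⟩) hTS
  · rw [Filter.le_generate_iff]
    rintro S ⟨T, hT, rfl⟩
    exact Filter.preimage_mem_comap hT

theorem isMaximalThickFilterH_comap_forget {m : ℕ} {p : Ultrafilter (FinSubsets m)}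
    (hp : IsThickUltrafilter p) :
    IsMaximalThickFilterH (Filter.comap (forget m) (p : Filter (FinSubsets m))) := by
  refine ⟨fun S hS => ?_, fun F' hF' hsub => le_antisymm hsub fun A hA => ?_⟩
  · obtain ⟨T, hT, hTS⟩ := hS
    exact (isThickH_preimage_forget_iff.2 (hp T hT)).mono hTS
  · refine ⟨{t | ∀ x, forget m x = t → x ∈ A}, ?_, fun x hx => hx x rfl⟩
    by_contra hT
    have hT' : {t | ∀ x, forget m x = t → x ∈ A}ᶜ ∈ p := Ultrafilter.compl_mem_iff_notMem.2 hT
    have hF : forget m ⁻¹' {t | ∀ x, forget m x = t → x ∈ A}ᶜ ∈ F' :=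
      hsub (Filter.preimage_mem_comap hT')
    obtain ⟨s, hs⟩ := hF' _ (Filter.inter_mem hF hA) m le_rfl
    -- All enumerations of the range of `s` are of the form `s ∘ f`, hence in `A`.
    refine (hs (Function.Embedding.refl _)).1 fun x hx => ?_
    obtain ⟨f, hf⟩ : ∃ f : Fin m → Fin m, ∀ i, s (f i) = x i := by
      have hr := (forget_eq_iff x s).1 hx
      exact ⟨_, fun i => (hr ▸ Set.mem_range_self i : x i ∈ Set.range s).choose_spec⟩
    have hinj : Function.Injective f := fun i j hij => x.injective (by rw [← hf, ← hf, hij])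
    have : (⟨f, hinj⟩ : Fin m ↪ Fin m).trans s = x := DFunLike.ext _ _ hf
    exact this ▸ (hs ⟨f, hinj⟩).2

namespace SamuelSInf

/-! ### Injections of `ω` as points of `S(S_∞)` -/

/-- The point of `S(S_∞)` given by an injection `h : ω → ω`: its coordinates are the principal
ultrafilters at the restrictions of `h`. Injections that are not surjective are allowed, as only
the restrictions of `h` to the finite ordinals matter. -/
def ofEmb (h : ℕ ↪ ℕ) : SamuelSInf :=
  ⟨fun _ => pure (Fin.valEmbedding.trans h), fun _ _ _ => rfl⟩

theorem mem_app_ofEmb {m : ℕ} (h : ℕ ↪ ℕ) (f : H m) (T : Set (H m)) :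
    T ∈ (ofEmb h).app f ↔ f.trans h ∈ T := Iff.rfl

theorem mul_ofEmb_app {m : ℕ} (α : SamuelSInf) (h : ℕ ↪ ℕ) (f : H m) :
    (α * ofEmb h).app f = α.app (f.trans h) :=
  Ultrafilter.ext fun T => mul_app α (ofEmb h) f T

theorem act_eq_mul_ofEmb (α : SamuelSInf) (g : Equiv.Perm ℕ) :
    α.act g = α * ofEmb g.toEmbedding := rfl

theorem app_valEmbedding (α : SamuelSInf) (m : ℕ) : α.app (Fin.valEmbedding : H m) = α.proj m := by
  rw [app_eq α Fin.valEmbedding m fun i => i.2]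
  rfl

/-- The push-forward of `α · f` to `[ω]^m` depends only on the range of `f`. -/
theorem map_forget_app_congr {m : ℕ} (α : SamuelSInf) {f f' : H m}
    (h : forget m f = forget m f') :
    (α.app f).map (forget m) = (α.app f').map (forget m) := by
  have hr := (forget_eq_iff f f').1 h
  have hb : ∀ i, f i < max (bound f) (bound f') := fun i => (lt_bound f i).trans_le (le_max_left _ _)
  have hb' : ∀ i, f' i < max (bound f) (bound f') :=
    fun i => (lt_bound f' i).trans_le (le_max_right _ _)
  rw [app_eq α f _ hb, app_eq α f' _ hb', Ultrafilter.map_map, Ultrafilter.map_map]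
  congr 1
  funext x
  refine (forget_eq_iff _ _).2 ?_
  have key : ∀ (e : H m) (he : ∀ i, e i < max (bound f) (bound f')),
      Set.range (dual (corestrict e _ he) x) = {a | ∃ j, j.val ∈ Set.range e ∧ x j = a} := by
    intro e he
    ext a
    constructor
    · rintro ⟨i, rfl⟩
      exact ⟨⟨e i, he i⟩, ⟨i, rfl⟩, rfl⟩
    · rintro ⟨j, ⟨i, hi⟩, rfl⟩
      exact ⟨i, congrArg x (Fin.ext hi)⟩
  rw [key f hb, key f' hb', hr]

/-- The finitely many conditions `f.trans x ∈ A`, `f : m → n`, hold for `α(n)`-most `x`, hence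
simultaneously for some `x`. -/
theorem isThickH_of_forall_mem_app {m : ℕ} (α : SamuelSInf) {A : Set (H m)}
    (hA : ∀ f : H m, A ∈ α.app f) : IsThickH A := by
  intro n _
  have : ∀ᶠ x in (α.proj n : Filter (H n)), ∀ f : Fin m ↪ Fin n, f.trans x ∈ A := by
    rw [Filter.eventually_all]
    intro f
    have := hA (f.trans Fin.valEmbedding)
    rwa [app_eq α (f.trans Fin.valEmbedding) n fun i => (f i).2] at this
  exact this.exists

theorem mem_levelFilter {Y : Set SamuelSInf} {m : ℕ} {A : Set (H m)} :
    A ∈ levelFilter Y m ↔ ∀ α ∈ Y, A ∈ α.proj m :=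
  Set.image_subset_iff

theorem mem_levelFilter_iff_app {M : Set SamuelSInf} (hM : IsRightIdeal M) {m : ℕ}
    {A : Set (H m)} : A ∈ levelFilter M m ↔ ∀ α ∈ M, ∀ f : H m, A ∈ α.app f := by
  rw [mem_levelFilter]
  refine ⟨fun h α hα f => ?_, fun h α hα => app_valEmbedding α m ▸ h α hα _⟩
  obtain ⟨g, rfl⟩ := exists_perm_restrict_eq f
  exact h _ (hM.2 α hα (ofEmb g.toEmbedding))

theorem levelFilter_neBot {Y : Set SamuelSInf} (hY : Y.Nonempty) (m : ℕ) :
    (levelFilter Y m).NeBot := by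
  obtain ⟨α, hα⟩ := hY
  refine ⟨fun h => (α.proj m).empty_notMem ?_⟩
  exact mem_levelFilter.1 (Filter.empty_mem_iff_bot.2 h) α hα

/-! ### Level filters of minimal right ideals -/

theorem isRightIdeal_range_mul (α : SamuelSInf) : IsRightIdeal (Set.range (α * ·)) := by
  refine ⟨⟨α * α, α, rfl⟩, ?_⟩
  rintro _ ⟨γ, rfl⟩ δ
  exact ⟨γ * δ, (mul_assoc α γ δ).symm⟩

/-- In a minimal right ideal `M`, a single point decides membership in the level filters, since
`M = β S(S_∞)` for each `β ∈ M`. -/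
theorem IsMinimalRightIdeal.mem_levelFilter_of_forall_mem_app {M : Set SamuelSInf}
    (hM : IsMinimalRightIdeal M) {β : SamuelSInf} (hβ : β ∈ M) {m : ℕ} {A : Set (H m)}
    (hA : ∀ f : H m, A ∈ β.app f) : A ∈ levelFilter M m := by
  have hMβ := hM.2 _ (isRightIdeal_range_mul β) (by rintro _ ⟨γ, rfl⟩; exact hM.1.2 β hβ γ)
  rw [mem_levelFilter, ← hMβ]
  rintro _ ⟨γ, rfl⟩
  exact Filter.Eventually.of_forall (f := (γ.proj m : Filter (H m))) hA

theorem IsMinimalRightIdeal.preimage_mem_or {M : Set SamuelSInf} (hM : IsMinimalRightIdeal M)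
    {m : ℕ} (T : Set (FinSubsets m)) :
    forget m ⁻¹' T ∈ levelFilter M m ∨ forget m ⁻¹' Tᶜ ∈ levelFilter M m := by
  obtain ⟨α, hα⟩ := hM.1.1
  obtain ⟨h, hh⟩ := exists_embedding_homogeneous
    (fun t => ∃ f : H m, (forget m f : Finset ℕ) = t ∧ forget m ⁻¹' T ∈ α.app f) m
  have hβ : α * ofEmb h ∈ M := hM.1.2 α hα _
  refine hh.imp (fun hh => ?_) (fun hh => ?_) <;>
    refine hM.mem_levelFilter_of_forall_mem_app hβ fun f => ?_ <;>
    rw [mul_ofEmb_app] <;>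
    have hf := hh (Finset.univ.map f) (by simp) <;>
    rw [Finset.map_map] at hf
  · obtain ⟨f', hf', hT⟩ := hf
    have := map_forget_app_congr α (f := f') (f' := f.trans h) (Subtype.ext hf')
    rw [← Ultrafilter.mem_map] at hT ⊢
    rwa [← this]
  · rw [Set.preimage_compl, Ultrafilter.compl_mem_iff_notMem]
    exact fun hT => hf ⟨_, rfl, hT⟩

theorem IsMinimalRightIdeal.exists_thick_ultrafilter {M : Set SamuelSInf}
    (hM : IsMinimalRightIdeal M) (m : ℕ) :
    ∃ p : Ultrafilter (FinSubsets m),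
      (p : Filter (FinSubsets m)) = Filter.map (forget m) (levelFilter M m) ∧
      IsThickUltrafilter p := by
  have hne := levelFilter_neBot hM.1.1 m
  refine ⟨Ultrafilter.ofComplNotMemIff (Filter.map (forget m) (levelFilter M m)) fun T =>
    ⟨fun hT => (hM.preimage_mem_or T).resolve_right hT, fun hT hT' => ?_⟩, rfl, fun T hT => ?_⟩
  · have := Filter.inter_mem hT hT'
    rw [Set.inter_compl_self] at this
    exact Filter.empty_notMem _ this
  · obtain ⟨α, hα⟩ := hM.1.1
    exact isThickH_preimage_forget_iff.1
      (isThickH_of_forall_mem_app α ((mem_levelFilter_iff_app hM.1).1 hT α hα))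

/-! ### Topology of `S(S_∞)` -/

theorem continuous_iff {X : Type*} [TopologicalSpace X] {F : X → SamuelSInf} :
    Continuous F ↔ ∀ m, Continuous fun x => (F x).proj m := by
  exact continuous_induced_rng.trans continuous_pi_iff

theorem continuous_proj (m : ℕ) : Continuous (proj m) := continuous_iff.1 continuous_id m

theorem continuous_ultrafilter_map {X Y : Type*} (f : X → Y) :
    Continuous (Ultrafilter.map f) :=
  continuous_generateFrom_iff.2 (by
    rintro _ ⟨s, rfl⟩
    exact ultrafilter_isOpen_basic (f ⁻¹' s))

instance : CompactSpace SamuelSInf := by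
  refine isCompact_iff_compactSpace.1 (IsClosed.isCompact (?_ : IsClosed
    {α : (n : ℕ) → Ultrafilter (H n) |
      ∀ (m n : ℕ) (h : m ≤ n), (α n).map (dual (Fin.castLEEmb h)) = α m}))
  simp only [Set.ofPred_forall]
  refine isClosed_iInter fun m => isClosed_iInter fun n => isClosed_iInter fun h => ?_
  exact isClosed_eq ((continuous_ultrafilter_map _).comp (continuous_apply n)) (continuous_apply m)

instance : T2Space SamuelSInf := inferInstanceAs (T2Space (Subtype _))

theorem continuous_mul_left (α : SamuelSInf) : Continuous (α * ·) := by
  refine continuous_iff.2 fun m => continuous_generateFrom_iff.2 ?_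
  rintro _ ⟨T, rfl⟩
  exact (ultrafilter_isOpen_basic {f | T ∈ α.app f}).preimage (continuous_proj m)

theorem isClosed_setOf_mem_app {m : ℕ} (f : H m) (A : Set (H m)) :
    IsClosed {α : SamuelSInf | A ∈ α.app f} :=
  (ultrafilter_isClosed_basic _).preimage (continuous_proj (bound f))

/-- `S_∞` is dense in `S(S_∞)`. -/
theorem denseRange_ofEmb_perm : DenseRange fun g : Equiv.Perm ℕ => ofEmb g.toEmbedding := by
  intro γ
  -- The permutations converge to `γ` along the filter generated by the cylinders over the members
  -- of the ultrafilters `γ(n)`.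
  let G : Filter (Equiv.Perm ℕ) :=
    ⨅ n, Filter.comap (fun g => restrict g n) (γ.proj n : Filter (H n))
  have hmono : Antitone fun n =>
      Filter.comap (fun g => restrict g n) (γ.proj n : Filter (H n)) := by
    intro m n h
    rintro S ⟨A, hA, hAS⟩
    refine ⟨dual (Fin.castLEEmb h) ⁻¹' A, ?_, hAS⟩
    have := γ.2 m n h
    change A ∈ γ.1 m at hA
    rw [← this] at hA
    exact hA
  have : G.NeBot := by
    have hne : ∀ n, (Filter.comap (fun g => restrict g n) (γ.proj n : Filter (H n))).NeBot :=
      fun n => (γ.proj n).neBot.comap_of_surj exists_perm_restrict_eq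
    exact Filter.iInf_neBot_of_directed hmono.directed_ge hne
  refine mem_closure_of_tendsto (b := G) (f := fun g => ofEmb g.toEmbedding) ?_
    (Filter.Eventually.of_forall fun g => Set.mem_range_self g)
  refine tendsto_subtype_rng.2 (tendsto_pi_nhds.2 fun n => ?_)
  refine TopologicalSpace.tendsto_nhds_generateFrom_iff.2 ?_
  rintro _ ⟨A, rfl⟩ hA
  exact Filter.mem_iInf_of_mem n ⟨A, hA, Set.Subset.rfl⟩

/-! ### Subflows and right ideals -/

theorem IsSubflow.isRightIdeal {Y : Set SamuelSInf} (hY : IsSubflow Y) : IsRightIdeal Y := by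
  refine ⟨hY.1, fun α hα γ => ?_⟩
  exact denseRange_ofEmb_perm.induction_on (p := fun γ => α * γ ∈ Y) γ
    (hY.2.1.preimage (continuous_mul_left α)) fun g => hY.2.2 α hα g

theorem isSubflow_range_mul (α : SamuelSInf) : IsSubflow (Set.range (α * ·)) :=
  ⟨(isRightIdeal_range_mul α).1, (isCompact_range (continuous_mul_left α)).isClosed,
    fun β hβ g => (isRightIdeal_range_mul α).2 β hβ (ofEmb g.toEmbedding)⟩

theorem IsMinimalSubflow.isMinimalRightIdeal {M : Set SamuelSInf} (hM : IsMinimalSubflow M) :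
    IsMinimalRightIdeal M := by
  refine ⟨hM.1.isRightIdeal, fun I hI hIM => hIM.antisymm ?_⟩
  obtain ⟨α, hα⟩ := hI.1
  rw [← hM.2 _ (isSubflow_range_mul α)
    (by rintro _ ⟨γ, rfl⟩; exact hIM (hI.2 α hα γ))]
  rintro _ ⟨γ, rfl⟩
  exact hI.2 α hα γ

theorem IsSubflow.exists_isMinimalSubflow_subset {Y : Set SamuelSInf} (hY : IsSubflow Y) :
    ∃ M ⊆ Y, IsMinimalSubflow M := by
  obtain ⟨M, hMY, hM⟩ := zorn_superset_nonempty {Z | IsSubflow Z} (fun c hc hchain hne => by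
    refine ⟨⋂₀ c, ⟨?_, isClosed_sInter fun Z hZ => (hc hZ).2.1, fun α hα g Z hZ =>
      (hc hZ).2.2 α (hα Z hZ) g⟩, fun Z hZ => Set.sInter_subset_of_mem hZ⟩
    have := hne.to_subtype
    exact IsCompact.nonempty_sInter_of_directed_nonempty_isCompact_isClosed
      (fun U hU V hV => (hchain.total hU hV).elim (fun h => ⟨U, hU, subset_rfl, h⟩)
        fun h => ⟨V, hV, h, subset_rfl⟩)
      (fun Z hZ => (hc hZ).1) (fun Z hZ => (hc hZ).2.1.isCompact)
      fun Z hZ => (hc hZ).2.1) Y hY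
  exact ⟨M, hMY, hM.prop, fun Z hZ hZM => hM.eq_of_subset hZ hZM⟩

/-! ### The subflow of a thick ultrafilter -/

/-- The set of all `α` such that the push-forward of each `α · f` to `[ω]^m` is `p`. -/
def fiberFlow {m : ℕ} (p : Ultrafilter (FinSubsets m)) : Set SamuelSInf :=
  {α | ∀ T ∈ p, ∀ f : H m, forget m ⁻¹' T ∈ α.app f}

theorem fiberFlow_nonempty {m : ℕ} {p : Ultrafilter (FinSubsets m)} (hp : IsThickUltrafilter p) :
    (fiberFlow p).Nonempty := by
  let Z : {T // T ∈ p} × ℕ → Set SamuelSInf := fun i =>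
    {α | ∀ f : H m, (∀ j, f j < i.2) → forget m ⁻¹' i.1.1 ∈ α.app f}
  have hclosed : ∀ i, IsClosed (Z i) := fun i => by
    simp only [Z, Set.ofPred_forall]
    exact isClosed_iInter fun f => isClosed_iInter fun _ => isClosed_setOf_mem_app f _
  have hdir : Directed (· ⊇ ·) Z := by
    rintro ⟨⟨S, hS⟩, a⟩ ⟨⟨T, hT⟩, b⟩
    refine ⟨⟨⟨S ∩ T, Filter.inter_mem hS hT⟩, max a b⟩, ?_, ?_⟩
    · exact fun α hα f hf => Filter.mem_of_superset
        (hα f fun j => (hf j).trans_le (le_max_left a b)) fun x hx => hx.1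
    · exact fun α hα f hf => Filter.mem_of_superset
        (hα f fun j => (hf j).trans_le (le_max_right a b)) fun x hx => hx.2
  have hne : ∀ i, (Z i).Nonempty := by
    rintro ⟨⟨T, hT⟩, n⟩
    -- Thickness is only available for sizes at least `m`.
    obtain ⟨s, hs⟩ := isThickH_preimage_forget_iff.2 (hp T hT) (max m n) (le_max_left _ _)
    obtain ⟨g, hg⟩ := exists_perm_restrict_eq s
    refine ⟨ofEmb g.toEmbedding, fun f hf => ?_⟩
    rw [mem_app_ofEmb]
    have := hs (corestrict f (max m n) fun j => (hf j).trans_le (le_max_right _ _))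
    rw [← hg] at this
    exact this
  have : Nonempty ({T // T ∈ p} × ℕ) := ⟨⟨⟨Set.univ, Filter.univ_mem⟩, 0⟩⟩
  obtain ⟨α, hα⟩ := IsCompact.nonempty_iInter_of_directed_nonempty_isCompact_isClosed Z hdir hne
    (fun i => (hclosed i).isCompact) hclosed
  exact ⟨α, fun T hT f => Set.mem_iInter.1 hα ⟨⟨T, hT⟩, bound f⟩ f (lt_bound f)⟩

theorem isSubflow_fiberFlow {m : ℕ} {p : Ultrafilter (FinSubsets m)} (hp : IsThickUltrafilter p) :
    IsSubflow (fiberFlow p) := by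
  refine ⟨fiberFlow_nonempty hp, ?_, fun α hα g T hT f => ?_⟩
  · simp only [fiberFlow, Set.ofPred_forall]
    exact isClosed_iInter fun T => isClosed_iInter fun _ => isClosed_iInter fun f =>
      isClosed_setOf_mem_app f _
  · rw [act_eq_mul_ofEmb, mul_ofEmb_app]
    exact hα T hT _

theorem map_levelFilter_eq_of_subset_fiberFlow {m : ℕ} {p : Ultrafilter (FinSubsets m)}
    {M : Set SamuelSInf} (hne : M.Nonempty) (hM : M ⊆ fiberFlow p) :
    Filter.map (forget m) (levelFilter M m) = p := by
  have := levelFilter_neBot hne m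
  refine p.unique fun T hT => mem_levelFilter.2 fun α hα => ?_
  rw [← app_valEmbedding]
  exact hM hα T hT _

end SamuelSInf

theorem mainTheorem6 :
    (∀ M : Set SamuelSInf, SamuelSInf.IsMinimalRightIdeal M → ∀ m : ℕ,
      ∃ p : Ultrafilter (FinSubsets m),
        (p : Filter (FinSubsets m)) = Filter.map (forget m) (SamuelSInf.levelFilter M m) ∧
        IsThickUltrafilter p) ∧
    (∀ (m : ℕ) (p : Ultrafilter (FinSubsets m)), IsThickUltrafilter p →
      IsMaximalThickFilterH
        (Filter.generate {S : Set (H m) | ∃ T ∈ p, S = forget m ⁻¹' T}) ∧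
      ∃ M : Set SamuelSInf, SamuelSInf.IsMinimalRightIdeal M ∧ SamuelSInf.IsMinimalSubflow M ∧
        (p : Filter (FinSubsets m)) = Filter.map (forget m) (SamuelSInf.levelFilter M m)) := by

  refine ⟨fun M hM m => hM.exists_thick_ultrafilter m, fun m p hp => ⟨?_, ?_⟩⟩
  · have := generate_preimage_eq_comap (forget m) (p : Filter (FinSubsets m))
    exact this ▸ isMaximalThickFilterH_comap_forget hp
  · obtain ⟨M, hMp, hM⟩ := (SamuelSInf.isSubflow_fiberFlow hp).exists_isMinimalSubflow_subset
    exact ⟨M, hM.isMinimalRightIdeal, hM,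
      (SamuelSInf.map_levelFilter_eq_of_subset_fiberFlow hM.1.1 hMp).symm⟩
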